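/- For $\tau$ in the upper half plane $\mathbb{H}=\{\tau\in\mathbb{C}:\operatorname{Im}\tau>0\}$ put $q=\exp(2\pi i\tau)$, let $(x;x)_\infty=\prod_{n=1}^\infty(1-x^n)$ for $|x|<1$, and let $\eta(\tau)=e^{2\pi i\tau/24}(q;q)_\infty$ be the Dedekind eta function. Then for every $\tau\in\mathbb{H}$ $$ W:=\left\{\frac{\eta(2\tau)\,\eta^2(3\tau)}{\eta^2(\tau)\,\eta(6\tau)}\right\}^4 =\left\{\frac{(q^2;q^2)_\infty\,(q^3;q^3)_\infty^2}{(q;q)_\infty^2\,(q^6;q^6)_\infty}\right\}^4 . $$ The function $W$ is holomorphic, both as a function of $\tau\in\mathbb{H}$ and as a function of $q$ with $0<|q|<1$, and it satisfies $$ q\frac{dW}{dq}=\frac{(q^2;q^2)_\infty^7\,(q^3;q^3)_\infty^7}{(q;q)_\infty^5\,(q^6;q^6)_\infty^5}\,(W-1) $$ and, equivalently, $$ \frac{dW}{d\tau}=2\pi i\,\frac{\eta^7(2\tau)\,\eta^7(3\tau)}{\eta^5(\tau)\,\eta^5(6\tau)}\,(W-1). $$ -/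

import Mathlib

/-- The infinite product `(q;q)_∞ = ∏_{n ≥ 1} (1 - q ^ n)`, for `|q| < 1`.
Thus `(q ^ k; q ^ k)_∞` is `qqInf (q ^ k)`. -/
noncomputable def qqInf (q : ℂ) : ℂ := ∏' n : ℕ, (1 - q ^ (n + 1))

/-- The level six function `W` as a quotient of Dedekind eta functions, in the variable `τ`. -/
noncomputable def etaW (τ : ℂ) : ℂ :=
  ((ModularForm.eta (2 * τ) * ModularForm.eta (3 * τ) ^ 2) /
    (ModularForm.eta τ ^ 2 * ModularForm.eta (6 * τ))) ^ 4

/-- The level six function `W` as a quotient of infinite products, in the variable `q`. -/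
noncomputable def prodW (q : ℂ) : ℂ :=
  ((qqInf (q ^ 2) * qqInf (q ^ 3) ^ 2) / (qqInf q ^ 2 * qqInf (q ^ 6))) ^ 4

section LevelSix
open UpperHalfPlane hiding I
open Complex hiding eta
open ModularForm EisensteinSeries MatrixGroups Filter Asymptotics
open scoped Real Manifold Topology CongruenceSubgroup

local notation "𝕢" => Function.Periodic.qParam

/-! Write [r] for `etaProd r`. With V = [-5,1,-1,5] and Y = [-5,7,7,-5], one has W = [-8,4,8,-4],
and Y is the eta quotient in the differential equation. The logarithmic derivative of [r] is 2πi/24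
times `E2comb r`. For W and V these Eisenstein combinations are themselves eta quotients: 192
[-2,4,-2,4] (`E2comb_W`) and 24 Y (`E2comb_Y`). Hence W and 8V have the same derivative, and
comparing limits at i∞ gives W - 1 = 8V (`etaProd_sub_one`). Therefore W' = 8V' = 2πi Y · 8V = 2πi Y
(W - 1).

For each Eisenstein identity, the 24th power of the quotient of the two sides has weight 0 on Γ₀(6),
free of the eta multiplier. It is bounded at the four cusps, hence constant (`levelSixRatio_const`).
Connectedness of ℍ removes the 24th power, and leading q-coefficients give the constant. -/

/-! ### Hermite normal forms and transformation laws -/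

/-- The point `(A τ + B) / D` of the upper half-plane, for `A, D > 0`. -/
noncomputable def affineAct (A B D : ℤ) (τ : ℍ) : ℍ := ofComplex ((A * τ + B) / D)

lemma affine_im_pos {A B D : ℤ} (hA : 0 < A) (hD : 0 < D) {z : ℂ} (hz : 0 < z.im) :
    0 < ((A * z + B) / D : ℂ).im := by
  have hA' : (0 : ℝ) < A := by exact_mod_cast hA
  have hD' : (0 : ℝ) < D := by exact_mod_cast hD
  have h : ((A * z + B) / D : ℂ).im = A * z.im / D := by
    rw [show (D : ℂ) = ((D : ℝ) : ℂ) by simp, Complex.div_ofReal_im]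
    simp
  rw [h]
  positivity

lemma coe_affineAct {A B D : ℤ} (hA : 0 < A) (hD : 0 < D) (τ : ℍ) :
    (affineAct A B D τ : ℂ) = (A * τ + B) / D := by
  rw [affineAct, ofComplex_apply_of_im_pos (affine_im_pos hA hD τ.im_pos)]

lemma affineAct_im {A B D : ℤ} (hA : 0 < A) (hD : 0 < D) (τ : ℍ) :
    (affineAct A B D τ).im = (A / D : ℝ) * τ.im := by
  rw [← coe_im, coe_affineAct hA hD, show (D : ℂ) = ((D : ℝ) : ℂ) by simp, Complex.div_ofReal_im]
  simp
  ring

lemma coe_SL_smul (γ : SL(2, ℤ)) (τ : ℍ) :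
    ((γ • τ : ℍ) : ℂ) = (γ 0 0 * τ + γ 0 1) / (γ 1 0 * τ + γ 1 1) := by
  rw [coe_specialLinearGroup_apply]
  simp

lemma SL_denom_ne_zero (γ : SL(2, ℤ)) (τ : ℍ) : (γ 1 0 * τ + γ 1 1 : ℂ) ≠ 0 := by
  have := denom_ne_zero (γ : GL (Fin 2) ℝ) τ
  simpa [ModularGroup.denom_apply] using this

/-- The matrix identity `diag(m, 1) γ = γ' (A B; 0 D)`, with `m, A, D > 0`. -/
structure HermiteDecomp (m : ℤ) (γ : SL(2, ℤ)) (A B D : ℤ) (γ' : SL(2, ℤ)) : Prop where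
  m_pos : 0 < m
  A_pos : 0 < A
  D_pos : 0 < D
  eq00 : m * γ 0 0 = γ' 0 0 * A
  eq01 : m * γ 0 1 = γ' 0 0 * B + γ' 0 1 * D
  eq10 : γ 1 0 = γ' 1 0 * A
  eq11 : γ 1 1 = γ' 1 0 * B + γ' 1 1 * D

namespace HermiteDecomp

variable {m A B D : ℤ} {γ γ' : SL(2, ℤ)}

lemma det_eq (h : HermiteDecomp m γ A B D γ') : m = A * D := by
  have h1 := Matrix.SpecialLinearGroup.det_coe γ
  have h2 := Matrix.SpecialLinearGroup.det_coe γ'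
  rw [Matrix.det_fin_two] at h1 h2
  linear_combination (γ 1 1) * h.eq00 - (γ 1 0) * h.eq01 - m * h1 + A * D * h2
    + (γ' 0 0 * A) * h.eq11 - (γ' 0 0 * B + γ' 0 1 * D) * h.eq10

/-- Cocycle relation for automorphy factors: diag(m, 1) contributes 1 and the triangular matrix
contributes D. -/
lemma denom_eq (h : HermiteDecomp m γ A B D γ') (τ : ℍ) :
    (γ' 1 0 * affineAct A B D τ + γ' 1 1 : ℂ) = (γ 1 0 * τ + γ 1 1) / D := by
  have hD : (D : ℂ) ≠ 0 := by exact_mod_cast h.D_pos.ne'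
  rw [coe_affineAct h.A_pos h.D_pos]
  have e3 : (γ 1 0 : ℂ) = γ' 1 0 * A := by exact_mod_cast h.eq10
  have e4 : (γ 1 1 : ℂ) = γ' 1 0 * B + γ' 1 1 * D := by exact_mod_cast h.eq11
  rw [e3, e4]
  field_simp
  ring

lemma smul_eq (h : HermiteDecomp m γ A B D γ') (τ : ℍ) :
    affineAct m 0 1 (γ • τ) = γ' • affineAct A B D τ := by
  have hD : (D : ℂ) ≠ 0 := by exact_mod_cast h.D_pos.ne'
  ext
  rw [coe_affineAct h.m_pos one_pos, coe_SL_smul, coe_SL_smul, h.denom_eq,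
    coe_affineAct h.A_pos h.D_pos]
  have hden := SL_denom_ne_zero γ τ
  have e1 : (m * γ 0 0 : ℂ) = γ' 0 0 * A := by exact_mod_cast h.eq00
  have e2 : (m * γ 0 1 : ℂ) = γ' 0 0 * B + γ' 0 1 * D := by exact_mod_cast h.eq01
  have hnum : (γ' 0 0 * ((A * τ + B) / D) + γ' 0 1 : ℂ) = m * (γ 0 0 * τ + γ 0 1) / D := by
    field_simp
    linear_combination -(τ : ℂ) * e1 - e2
  rw [hnum, div_div_div_cancel_right₀ hD]
  simp [mul_div_assoc]

lemma discriminant_eq (h : HermiteDecomp m γ A B D γ') (τ : ℍ) :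
    discriminant (affineAct m 0 1 (γ • τ)) =
      ((γ 1 0 * τ + γ 1 1) / D) ^ 12 * discriminant (affineAct A B D τ) := by
  have hs : (discriminant ∣[(12 : ℤ)] γ') (affineAct A B D τ) = discriminant (affineAct A B D τ) :=
    congrFun (SlashInvariantForm.slash_action_generators_SL2Z
      discriminant_S_invariant discriminant_T_invariant γ') _
  rw [ModularForm.SL_slash_apply, ModularGroup.denom_apply] at hs
  have hne := SL_denom_ne_zero γ' (affineAct A B D τ)
  rw [h.smul_eq, ← h.denom_eq, ← hs, mul_left_comm, zpow_neg, zpow_ofNat,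
    mul_inv_cancel₀ (pow_ne_zero _ hne), mul_one]

/-- The factor m on the left makes the non-modular term depend on γ and τ only, so it can cancel
between levels. -/
lemma E2_eq (h : HermiteDecomp m γ A B D γ') (τ : ℍ) :
    m * E2 (affineAct m 0 1 (γ • τ)) =
      (γ 1 0 * τ + γ 1 1) ^ 2 * (A / D * E2 (affineAct A B D τ))
        + 6 / (π * I) * (γ 1 0) * (γ 1 0 * τ + γ 1 1) := by
  have hs := congrFun (E2_slash_action γ') (affineAct A B D τ)
  have hmAD : (m : ℂ) = A * D := by exact_mod_cast h.det_eq
  have hD : (D : ℂ) ≠ 0 := by exact_mod_cast h.D_pos.ne'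
  have e3 : (γ 1 0 : ℂ) = γ' 1 0 * A := by exact_mod_cast h.eq10
  have hden := SL_denom_ne_zero γ τ
  have hpi : (π : ℂ) ≠ 0 := by exact_mod_cast Real.pi_ne_zero
  rw [h.smul_eq]
  simp only [ModularForm.SL_slash_apply, Pi.sub_apply, Pi.smul_apply, D2, smul_eq_mul,
    ModularGroup.denom_apply, riemannZeta_two, h.denom_eq] at hs
  set e := E2 (γ' • affineAct A B D τ)
  set J : ℂ := γ 1 0 * τ + γ 1 1
  have h2 : e = (J / D) ^ 2 * (E2 (affineAct A B D τ) -
      1 / (2 * (π ^ 2 / 6)) * (2 * π * I * γ' 1 0 / (J / D))) := by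
    rw [← hs, zpow_neg]
    norm_cast
    field_simp
  rw [h2, hmAD, e3]
  field_simp
  linear_combination (-6 * A * D * (γ' 1 0 : ℂ)) * I_sq

end HermiteDecomp

/-! ### Level six combinations and their invariance under Γ₀(6) -/

/-- The divisors of six. -/
def levels : Fin 4 → ℤ := ![1, 2, 3, 6]

lemma levels_pos (i : Fin 4) : 0 < levels i := by
  fin_cases i <;> simp [levels]

/-- The combination `∑ cₘ m E₂(m τ)` over the divisors `m` of six. -/
noncomputable def E2comb (c : Fin 4 → ℤ) (τ : ℍ) : ℂ :=
  ∑ i, c i * (levels i * E2 (affineAct (levels i) 0 1 τ))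

/-- The quotient `∏ Δ(m τ) ^ rₘ` over the divisors `m` of six. -/
noncomputable def deltaQuot (r : Fin 4 → ℤ) (τ : ℍ) : ℂ :=
  ∏ i, discriminant (affineAct (levels i) 0 1 τ) ^ r i

lemma E2comb_smul {c A B D : Fin 4 → ℤ} {γ : SL(2, ℤ)} {γ' : Fin 4 → SL(2, ℤ)} (hc : ∑ i, c i = 0)
    (h : ∀ i, HermiteDecomp (levels i) γ (A i) (B i) (D i) (γ' i)) (τ : ℍ) :
    E2comb c (γ • τ) = (γ 1 0 * τ + γ 1 1) ^ 2 *
      ∑ i, c i * (A i / D i * E2 (affineAct (A i) (B i) (D i) τ)) := by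
  have hc' : ∑ i, (c i : ℂ) = 0 := by exact_mod_cast hc
  simp_rw [E2comb, fun i ↦ (h i).E2_eq τ]
  set J : ℂ := γ 1 0 * τ + γ 1 1
  set w : ℂ := 6 / (π * I) * (γ 1 0) * J
  -- Every level carries the same anomaly `w`, so the total is `w` times the vanishing sum of the `c
  -- i`.
  rw [Finset.mul_sum, ← sub_eq_zero, ← Finset.sum_sub_distrib, ← zero_mul w, ← hc', Finset.sum_mul]
  exact Finset.sum_congr rfl fun i _ ↦ by ring

lemma deltaQuot_smul {r A B D : Fin 4 → ℤ} {γ : SL(2, ℤ)} {γ' : Fin 4 → SL(2, ℤ)}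
    (hr : ∑ i, r i = 4) (h : ∀ i, HermiteDecomp (levels i) γ (A i) (B i) (D i) (γ' i)) (τ : ℍ) :
    deltaQuot r (γ • τ) = (γ 1 0 * τ + γ 1 1) ^ 48 * ((∏ i, (D i : ℂ) ^ (12 * r i))⁻¹ *
      ∏ i, discriminant (affineAct (A i) (B i) (D i) τ) ^ r i) := by
  have hJ := SL_denom_ne_zero γ τ
  set J : ℂ := γ 1 0 * τ + γ 1 1
  have h1 : ∀ i, discriminant (affineAct (levels i) 0 1 (γ • τ)) ^ r i =
      J ^ (12 * r i) * (((D i : ℂ) ^ (12 * r i))⁻¹ *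
        discriminant (affineAct (A i) (B i) (D i) τ) ^ r i) := fun i ↦ by
    rw [(h i).discriminant_eq τ, mul_zpow, ← zpow_natCast, ← zpow_mul, div_zpow, div_eq_mul_inv,
      mul_assoc]
    rfl
  -- The weight is 12 · 4 = 48, matching the 24th power of a weight 2 form.
  have h2 : ∏ i, J ^ (12 * r i) = J ^ 48 := by
    have h3 : ∀ s : Finset (Fin 4), ∏ i ∈ s, J ^ (12 * r i) = J ^ (∑ i ∈ s, 12 * r i) := by
      intro s
      induction s using Finset.induction_on with
      | empty => simp
      | insert a s ha ih => rw [Finset.prod_insert ha, Finset.sum_insert ha, zpow_add₀ hJ, ih]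
    rw [h3, ← Finset.mul_sum, hr]
    norm_cast
  simp_rw [deltaQuot, h1, Finset.prod_mul_distrib, h2, Finset.prod_inv_distrib]

/-- A weight zero function of level six attached to an Eisenstein series and an eta quotient. -/
noncomputable def levelSixRatio (c r : Fin 4 → ℤ) (τ : ℍ) : ℂ := E2comb c τ ^ 24 / deltaQuot r τ

lemma levelSixRatio_smul {c r A B D : Fin 4 → ℤ} {γ : SL(2, ℤ)} {γ' : Fin 4 → SL(2, ℤ)}
    (hc : ∑ i, c i = 0) (hr : ∑ i, r i = 4)
    (h : ∀ i, HermiteDecomp (levels i) γ (A i) (B i) (D i) (γ' i)) (τ : ℍ) :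
    levelSixRatio c r (γ • τ) = (∏ i, (D i : ℂ) ^ (12 * r i)) *
      ((∑ i, c i * (A i / D i * E2 (affineAct (A i) (B i) (D i) τ))) ^ 24 *
        (∏ i, discriminant (affineAct (A i) (B i) (D i) τ) ^ r i)⁻¹) := by
  have hJ := SL_denom_ne_zero γ τ
  rw [levelSixRatio, E2comb_smul hc h, deltaQuot_smul hr h, mul_pow, ← pow_mul,
    mul_div_mul_left _ _ (pow_ne_zero _ hJ), div_eq_mul_inv, mul_inv, inv_inv]
  ring

lemma hermiteDecomp_Gamma0 {γ : SL(2, ℤ)} (hγ : γ ∈ CongruenceSubgroup.Gamma0 6) (m : ℤ)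
    (hm : 0 < m) (hm6 : m ∣ 6) : ∃ γ', HermiteDecomp m γ m 0 1 γ' := by
  rw [CongruenceSubgroup.Gamma0_mem, ZMod.intCast_zmod_eq_zero_iff_dvd] at hγ
  obtain ⟨k, hk⟩ := hm6.trans hγ
  have hdet := Matrix.SpecialLinearGroup.det_coe γ
  rw [Matrix.det_fin_two] at hdet
  -- The conjugate of γ by diag(m, 1), integral because m divides the lower left entry.
  refine ⟨⟨!![γ 0 0, m * γ 0 1; k, γ 1 1], ?_⟩, hm, hm, one_pos, ?_, ?_, ?_, ?_⟩
  · rw [Matrix.det_fin_two_of]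
    linear_combination hdet + γ 0 1 * hk
  all_goals simp
  · ring
  · linear_combination hk

lemma levelSixRatio_Gamma0 {c r : Fin 4 → ℤ} (hc : ∑ i, c i = 0) (hr : ∑ i, r i = 4)
    {γ : SL(2, ℤ)} (hγ : γ ∈ CongruenceSubgroup.Gamma0 6) (τ : ℍ) :
    levelSixRatio c r (γ • τ) = levelSixRatio c r τ := by
  choose γ' h using fun i ↦ hermiteDecomp_Gamma0 hγ (levels i) (levels_pos i)
    (by fin_cases i <;> simp [levels])
  rw [levelSixRatio_smul (A := levels) (B := 0) (D := 1) hc hr h]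
  simp [levelSixRatio, E2comb, deltaQuot, div_eq_mul_inv]

/-! ### Holomorphy -/

lemma mdifferentiable_comp_affineAct {F : ℍ → ℂ} (hF : MDiff F) {A B D : ℤ} (hA : 0 < A)
    (hD : 0 < D) : MDiff (fun τ ↦ F (affineAct A B D τ)) := by
  rw [UpperHalfPlane.mdifferentiable_iff] at hF ⊢
  have h := hF.comp (f := fun z : ℂ ↦ (A * z + B) / D) (s := upperHalfPlaneSet)
    (by fun_prop) (fun z hz ↦ affine_im_pos hA hD hz)
  refine h.congr fun z hz ↦ ?_
  simp [affineAct, ofComplex_apply_of_im_pos hz]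

lemma mdifferentiable_discriminant : MDiff discriminant := CuspForm.discriminant.holo'

lemma mdifferentiable_E2comb (c : Fin 4 → ℤ) : MDiff (E2comb c) := by
  have h := fun i ↦ UpperHalfPlane.mdifferentiable_iff.mp
    (mdifferentiable_comp_affineAct E2_mdifferentiable (B := 0) (levels_pos i) one_pos)
  rw [UpperHalfPlane.mdifferentiable_iff]
  exact DifferentiableOn.fun_sum (u := Finset.univ) (A := fun i z ↦ (c i : ℂ) *
      (levels i * E2 (affineAct (levels i) 0 1 (ofComplex z))))
    fun i _ ↦ ((h i).const_mul (levels i : ℂ)).const_mul (c i : ℂ)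

lemma mdifferentiable_levelSixRatio (c r : Fin 4 → ℤ) : MDiff (levelSixRatio c r) := by
  have h := fun i ↦ UpperHalfPlane.mdifferentiable_iff.mp
    (mdifferentiable_comp_affineAct mdifferentiable_discriminant (B := 0) (levels_pos i) one_pos)
  have h1 := UpperHalfPlane.mdifferentiable_iff.mp (mdifferentiable_E2comb c)
  rw [UpperHalfPlane.mdifferentiable_iff]
  refine (h1.pow 24).div (DifferentiableOn.fun_finsetProd (u := Finset.univ) fun i _ ↦
    (h i).zpow (Or.inl fun z _ ↦ discriminant_ne_zero _)) fun z _ ↦ ?_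
  exact Finset.prod_ne_zero_iff.mpr fun i _ ↦ zpow_ne_zero _ (discriminant_ne_zero _)

/-! ### Growth at i∞ -/

lemma tendsto_affineAct {A D : ℤ} (B : ℤ) (hA : 0 < A) (hD : 0 < D) :
    Tendsto (affineAct A B D) atImInfty atImInfty := by
  rw [atImInfty, tendsto_comap_iff]
  have hA' : (0 : ℝ) < A := by exact_mod_cast hA
  have hD' : (0 : ℝ) < D := by exact_mod_cast hD
  refine (tendsto_comap.const_mul_atTop (div_pos hA' hD')).congr fun τ ↦ ?_
  rw [Function.comp_apply, affineAct_im hA hD]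

/-- A two-sided estimate is needed because discriminants occur with exponents of both signs. -/
lemma discriminant_isTheta :
    discriminant =Θ[atImInfty] fun τ ↦ Real.exp (-2 * π * τ.im) := by
  refine ⟨?_, exp_isBigO_discriminant⟩
  have h := CuspFormClass.exp_decay_atImInfty (h := 1) CuspForm.discriminant one_pos
    one_mem_strictPeriods_SL
  simpa using! h

lemma E2_sub_isBigO_sq :
    (fun τ : ℍ ↦ E2 τ - (1 - 24 * 𝕢 1 τ)) =O[atImInfty] fun τ : ℍ ↦ 𝕢 1 τ ^ 2 := by
  have hq (τ : ℍ) : 𝕢 1 τ ≠ 0 := Function.Periodic.qParam_ne_zero _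
  -- Removing the first two coefficients and dividing by q² leaves a q-series again, hence a bounded
  -- function.
  have h (τ : ℍ) : HasSum (fun m : ℕ ↦ (-24 * ArithmeticFunction.sigma 1 (m + 2) : ℂ) • 𝕢 1 τ ^ m)
      ((E2 τ - (1 - 24 * 𝕢 1 τ)) / 𝕢 1 τ ^ 2) := by
    have h1 := hasSum_qExpansion_E2 (z := τ)
    rw [← hasSum_nat_add_iff' 2] at h1
    have h2 := h1.div_const (𝕢 1 τ ^ 2)
    have hqe : cexp (2 * π * I * τ) = 𝕢 1 τ := by simp [Function.Periodic.qParam]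
    have e1 : (fun m : ℕ ↦ (-24 * ArithmeticFunction.sigma 1 (m + 2) : ℂ) • 𝕢 1 τ ^ m) =
        fun m : ℕ ↦ (if m + 2 = 0 then 1 else -24 * ArithmeticFunction.sigma 1 (m + 2) : ℂ) •
          cexp (2 * π * I * τ) ^ (m + 2) / 𝕢 1 τ ^ 2 := by
      ext m
      have := hq τ
      rw [hqe, pow_add, if_neg (by lia), smul_eq_mul, smul_eq_mul]
      field_simp
    have e2 : E2 τ - (1 - 24 * 𝕢 1 τ) = E2 τ - ∑ i ∈ Finset.range 2,
        (if i = 0 then 1 else -24 * ArithmeticFunction.sigma 1 i : ℂ) •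
          cexp (2 * π * I * τ) ^ i := by
      simp [Finset.sum_range_succ, hqe]
      ring
    rw [e1, e2]
    exact h2
  have hb : (fun τ : ℍ ↦ (E2 τ - (1 - 24 * 𝕢 1 τ)) / 𝕢 1 τ ^ 2 * 𝕢 1 τ ^ 2)
      =O[atImInfty] fun τ : ℍ ↦ (1 : ℝ) * ‖𝕢 1 τ ^ 2‖ :=
    IsBigO.mul (isBoundedAtImInfty_of_hasSum_qExpansion one_pos h)
      (isBigO_refl (fun τ : ℍ ↦ 𝕢 1 τ ^ 2) atImInfty).norm_right
  simp only [one_mul, isBigO_norm_right] at hb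
  refine hb.congr_left fun τ ↦ ?_
  rw [div_mul_cancel₀ _ (pow_ne_zero _ (hq τ))]

lemma E2_sub_one_isBigO :
    (fun τ ↦ E2 τ - 1) =O[atImInfty] fun τ ↦ Real.exp (-2 * π * τ.im) := by
  have h0 : Tendsto (fun τ : ℍ ↦ 𝕢 1 τ) atImInfty (𝓝 0) := qParam_tendsto_atImInfty one_pos
  have h1 : (fun τ : ℍ ↦ 𝕢 1 τ ^ 2) =O[atImInfty] fun τ : ℍ ↦ 𝕢 1 τ := by
    simpa [sq] using (h0.isBigO_one ℂ).mul (isBigO_refl (fun τ : ℍ ↦ 𝕢 1 τ) atImInfty)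
  have h2 := (E2_sub_isBigO_sq.trans h1).sub
    ((isBigO_refl (fun τ : ℍ ↦ 𝕢 1 τ) atImInfty).const_mul_left 24)
  refine (h2.congr_left fun τ ↦ by ring).trans (IsBigO.of_bound 1 (.of_forall fun τ ↦ ?_))
  simp [Function.Periodic.norm_qParam]

/-- Here `e` is the order in q of the eta quotient at the cusp, and the Eisenstein sum must vanish
at least as fast. For `e = 0` boundedness of E₂ suffices. Otherwise the constant term must cancel,
and each remaining tail decays like q^(A/D) with A/D ≥ e. -/
lemma isBoundedAtImInfty_E2_div_discriminant {c r A B D : Fin 4 → ℤ} (hA : ∀ i, 0 < A i) (hD : ∀ i, 0 < D i) (e : ℝ)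
    (he : ∑ i, r i * (A i / D i : ℝ) = 24 * e)
    (hcusp : e = 0 ∨ (∑ i, c i * (A i / D i : ℂ) = 0 ∧ ∀ i, e ≤ (A i / D i : ℝ))) :
    IsBoundedAtImInfty fun τ ↦ (∑ i, c i * (A i / D i * E2 (affineAct (A i) (B i) (D i) τ))) ^ 24 *
        (∏ i, discriminant (affineAct (A i) (B i) (D i) τ) ^ r i)⁻¹ := by
  have hz := fun i ↦ tendsto_affineAct (B i) (hA i) (hD i)
  have h1 : (fun τ ↦ ∑ i, c i * (A i / D i * E2 (affineAct (A i) (B i) (D i) τ)))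
      =O[atImInfty] fun τ : ℍ ↦ Real.exp (-2 * π * e * τ.im) := by
    rcases hcusp with rfl | ⟨hc, hmin⟩
    · simp only [mul_zero, zero_mul, Real.exp_zero]
      exact IsBigO.fun_sum fun i _ ↦
        (IsBigO.const_mul_left (isBoundedAtImInfty_E2.comp_tendsto (hz i)) _).const_mul_left _
    · have : (fun τ ↦ ∑ i, c i * (A i / D i * E2 (affineAct (A i) (B i) (D i) τ))) =
          fun τ ↦ ∑ i, c i * (A i / D i * (E2 (affineAct (A i) (B i) (D i) τ) - 1)) := by
        ext τ
        rw [← sub_eq_zero, ← Finset.sum_sub_distrib, ← hc]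
        exact Finset.sum_congr rfl fun i _ ↦ by ring
      rw [this]
      refine IsBigO.fun_sum fun i _ ↦ (IsBigO.const_mul_left ?_ _).const_mul_left _
      refine (E2_sub_one_isBigO.comp_tendsto (hz i)).trans (IsBigO.of_bound 1 (.of_forall fun τ ↦ ?_))
      simp only [Function.comp_apply, affineAct_im (hA i) (hD i), Real.norm_eq_abs, Real.abs_exp,
        one_mul, Real.exp_le_exp]
      have := mul_le_mul_of_nonneg_right (hmin i) (mul_pos Real.two_pi_pos τ.im_pos).le
      linarith
  have h2 : (fun τ ↦ ∏ i, discriminant (affineAct (A i) (B i) (D i) τ) ^ r i)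
      =Θ[atImInfty] fun τ : ℍ ↦ Real.exp (-2 * π * e * τ.im) ^ 24 := by
    have h3 : ∀ i ∈ Finset.univ, (fun τ ↦ discriminant (affineAct (A i) (B i) (D i) τ) ^ r i)
        =Θ[atImInfty] fun τ : ℍ ↦ Real.exp (-2 * π * (A i / D i * τ.im)) ^ r i := fun i _ ↦ by
      have h4 : (fun τ ↦ discriminant (affineAct (A i) (B i) (D i) τ))
          =Θ[atImInfty] fun τ : ℍ ↦ Real.exp (-2 * π * (A i / D i * τ.im)) := by
        have h5 := discriminant_isTheta.1.comp_tendsto (hz i)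
        have h6 := discriminant_isTheta.2.comp_tendsto (hz i)
        simp only [Function.comp_def, affineAct_im (hA i) (hD i)] at h5 h6
        exact ⟨h5, h6⟩
      exact h4.zpow _
    refine (IsTheta.finsetProd h3).trans (EventuallyEq.isTheta (.of_forall fun τ ↦ ?_))
    simp only [← Real.rpow_intCast, ← Real.exp_mul, ← Real.exp_sum, ← Real.exp_nat_mul]
    congr 1
    have : ∑ i, (-2 * π * (A i / D i * τ.im)) * (r i : ℝ) =
        -2 * π * τ.im * ∑ i, r i * (A i / D i : ℝ) := by
      rw [Finset.mul_sum]
      exact Finset.sum_congr rfl fun i _ ↦ by ring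
    rw [this, he]
    push_cast
    ring
  refine ((h1.pow 24).mul h2.inv.isBigO).trans (EventuallyEq.isBigO (.of_forall fun τ ↦ ?_))
  exact mul_inv_cancel₀ (pow_ne_zero _ (Real.exp_pos _).ne')

/-! ### The four cusps and constancy -/

/-- Matrices sending `∞` to representatives of the four cusps of `Γ₀(6)`. -/
def cuspRep : Fin 4 → SL(2, ℤ) :=
  ![1, ModularGroup.S, ⟨!![1, 0; 2, 1], by simp⟩, ⟨!![1, 0; 3, 1], by simp⟩]

/-- The expression is the lower left entry of γ (σᵢ Tʲ)⁻¹ modulo 6, for γ with bottom row (c, d) and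
σᵢ = `cuspRep i`. -/
lemma exists_cuspRep_row : ∀ a b c d : ZMod 6, a * d - b * c = 1 → ∃ i : Fin 4, ∃ j : ZMod 6,
    c * ((![0, 1, 2, 3] i) * j + ![1, 0, 1, 1] i) - d * (![0, 1, 2, 3] i) = 0 := by
  decide

lemma exists_mul_cuspRep (γ : SL(2, ℤ)) : ∃ δ ∈ CongruenceSubgroup.Gamma0 6, ∃ i : Fin 4, ∃ j : ℤ,
    γ = δ * (cuspRep i * ModularGroup.T ^ j) := by
  have hdet := Matrix.SpecialLinearGroup.det_coe γ
  rw [Matrix.det_fin_two] at hdet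
  have hdet' : (γ 0 0 : ZMod 6) * γ 1 1 - γ 0 1 * γ 1 0 = 1 := by exact_mod_cast congrArg _ hdet
  obtain ⟨i, j, hij⟩ := exists_cuspRep_row (γ 0 0) (γ 0 1) (γ 1 0) (γ 1 1) hdet'
  refine ⟨γ * (cuspRep i * ModularGroup.T ^ (j.val : ℤ))⁻¹, ?_, i, j.val, by group⟩
  rw [CongruenceSubgroup.Gamma0_mem, ← hij, Matrix.SpecialLinearGroup.coe_mul,
    Matrix.SpecialLinearGroup.coe_inv, Matrix.adjugate_fin_two, Matrix.SpecialLinearGroup.coe_mul,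
    ModularGroup.coe_T_zpow]
  fin_cases i <;> simp [cuspRep, Matrix.mul_apply, Fin.sum_univ_two, ModularGroup.S] <;> ring

lemma levelSixRatio_isBounded {c r A B D : Fin 4 → ℤ} {γ : SL(2, ℤ)} {γ' : Fin 4 → SL(2, ℤ)}
    (hc : ∑ i, c i = 0) (hr : ∑ i, r i = 4)
    (h : ∀ i, HermiteDecomp (levels i) γ (A i) (B i) (D i) (γ' i)) (e : ℝ)
    (he : ∑ i, r i * (A i / D i : ℝ) = 24 * e)
    (hcusp : e = 0 ∨ (∑ i, c i * (A i / D i : ℂ) = 0 ∧ ∀ i, e ≤ (A i / D i : ℝ))) :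
    IsBoundedAtImInfty fun τ ↦ levelSixRatio c r (γ • τ) := by
  simp_rw [levelSixRatio_smul hc hr h]
  exact (isBoundedAtImInfty_E2_div_discriminant (fun i ↦ (h i).A_pos) (fun i ↦ (h i).D_pos) e he hcusp).const_mul_left _

lemma levelSixRatio_const {c r : Fin 4 → ℤ} (hc : ∑ i, c i = 0) (hr : ∑ i, r i = 4)
    (h : ∀ i, IsBoundedAtImInfty fun τ ↦ levelSixRatio c r (cuspRep i • τ)) :
    ∃ C, ∀ τ, levelSixRatio c r τ = C := by
  let f : ModularForm ((CongruenceSubgroup.Gamma0 6 : Subgroup SL(2, ℤ)) :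
      Subgroup (GL (Fin 2) ℝ)) 0 :=
    { toFun := levelSixRatio c r
      slash_action_eq' := by
        rintro _ ⟨γ, hγ, rfl⟩
        ext τ
        have h1 := ModularForm.SL_slash_apply (k := 0) (levelSixRatio c r) γ τ
        rw [levelSixRatio_Gamma0 hc hr hγ, neg_zero, zpow_zero, mul_one] at h1
        exact h1
      holo' := mdifferentiable_levelSixRatio c r
      bdd_at_cusps' := by
        intro k hk
        rw [Subgroup.IsArithmetic.isCusp_iff_isCusp_SL2Z] at hk
        rw [OnePoint.isBoundedAt_iff_forall_SL2Z hk]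
        rintro γ -
        -- Invariance absorbs δ, and Tʲ preserves heights, so only the four representatives matter.
        obtain ⟨δ, hδ, i, j, rfl⟩ := exists_mul_cuspRep γ
        have hT : Tendsto (fun τ : ℍ ↦ ModularGroup.T ^ j • τ) atImInfty atImInfty := by
          rw [atImInfty, tendsto_comap_iff]
          refine tendsto_comap.congr fun τ ↦ ?_
          rw [Function.comp_apply, modular_T_zpow_smul, vadd_im]
        refine ((h i).comp_tendsto hT).congr_left fun τ ↦ ?_
        rw [ModularForm.SL_slash_apply, neg_zero, zpow_zero, mul_one, mul_smul,
          levelSixRatio_Gamma0 hc hr hδ, mul_smul]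
        rfl }
  obtain ⟨C, hC⟩ := ModularForm.eq_const_of_weight_zero f
  exact ⟨C, fun τ ↦ congrFun hC τ⟩

/-- The table rows are the cusps ∞, 0, 1/2, 1/3 and the columns the levels 1, 2, 3, 6. The entries
are A/D = gcd(m, u)²/m, with u the lower left entry of the representative. `e k` is the order of the
eta quotient at the k-th cusp. -/
lemma levelSixRatio_isBounded_cuspRep {c r : Fin 4 → ℤ} (hc : ∑ i, c i = 0) (hr : ∑ i, r i = 4)
    (e : Fin 4 → ℝ)
    (h : ∀ k, ∑ i, r i * ((![![1, 2, 3, 6], ![1, 1 / 2, 1 / 3, 1 / 6], ![1, 2, 1 / 3, 2 / 3],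
      ![1, 1 / 2, 3, 3 / 2]] : Fin 4 → Fin 4 → ℝ) k i) = 24 * e k)
    (hcusp : ∀ k, e k = 0 ∨ (∑ i, c i * ((![![1, 2, 3, 6], ![1, 1 / 2, 1 / 3, 1 / 6],
      ![1, 2, 1 / 3, 2 / 3], ![1, 1 / 2, 3, 3 / 2]] : Fin 4 → Fin 4 → ℂ) k i) = 0 ∧
      ∀ i, e k ≤ (![![1, 2, 3, 6], ![1, 1 / 2, 1 / 3, 1 / 6], ![1, 2, 1 / 3, 2 / 3],
      ![1, 1 / 2, 3, 3 / 2]] : Fin 4 → Fin 4 → ℝ) k i)) (k : Fin 4) :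
    IsBoundedAtImInfty fun τ ↦ levelSixRatio c r (cuspRep k • τ) := by
  have h := h k
  have hcusp := hcusp k
  fin_cases k
  · refine levelSixRatio_isBounded (A := ![1, 2, 3, 6]) (B := 0) (D := 1) (γ' := fun _ ↦ 1)
      hc hr (fun i ↦ ?_) (e 0) ?_ ?_
    · constructor <;> fin_cases i <;> simp [levels, cuspRep]
    · simpa [Fin.sum_univ_four] using h
    · simpa [Fin.sum_univ_four, Fin.forall_fin_succ] using hcusp
  · refine levelSixRatio_isBounded (A := 1) (B := 0) (D := ![1, 2, 3, 6])
      (γ' := fun _ ↦ ModularGroup.S) hc hr (fun i ↦ ?_) (e 1) ?_ ?_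
    · constructor <;> fin_cases i <;> simp [levels, cuspRep, ModularGroup.S]
    · simpa [Fin.sum_univ_four] using h
    · simpa [Fin.sum_univ_four, Fin.forall_fin_succ] using hcusp
  · refine levelSixRatio_isBounded (A := ![1, 2, 1, 2]) (B := ![0, 0, -1, 1]) (D := ![1, 1, 3, 3])
      (γ' := ![⟨!![1, 0; 2, 1], by simp⟩, ⟨!![1, 0; 1, 1], by simp⟩, ⟨!![3, 1; 2, 1], by simp⟩,
        ⟨!![3, -1; 1, 0], by simp⟩]) hc hr (fun i ↦ ?_) (e 2) ?_ ?_
    · constructor <;> fin_cases i <;> simp [levels, cuspRep]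
    · simpa [Fin.sum_univ_four] using h
    · simpa [Fin.sum_univ_four, Fin.forall_fin_succ] using hcusp
  · refine levelSixRatio_isBounded (A := ![1, 1, 3, 3]) (B := ![0, 1, 0, 1]) (D := ![1, 2, 1, 2])
      (γ' := ![⟨!![1, 0; 3, 1], by simp⟩, ⟨!![2, -1; 3, -1], by simp⟩, ⟨!![1, 0; 1, 1], by simp⟩,
        ⟨!![2, -1; 1, 0], by simp⟩]) hc hr (fun i ↦ ?_) (e 3) ?_ ?_
    · constructor <;> fin_cases i <;> simp [levels, cuspRep]
    · simpa [Fin.sum_univ_four] using h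
    · simpa [Fin.sum_univ_four, Fin.forall_fin_succ] using hcusp

lemma levelSixRatio_const_W :
    ∃ C, ∀ τ, levelSixRatio ![-8, 4, 8, -4] ![-2, 4, -2, 4] τ = C := by
  have hc : ∑ i, (![-8, 4, 8, -4] : Fin 4 → ℤ) i = 0 := by simp [Fin.sum_univ_four]
  have hr : ∑ i, (![-2, 4, -2, 4] : Fin 4 → ℤ) i = 4 := by simp [Fin.sum_univ_four]
  refine levelSixRatio_const hc hr (levelSixRatio_isBounded_cuspRep hc hr ![1, 0, 1 / 3, 0] ?_ ?_)
  · intro k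
    fin_cases k <;> simp [Fin.sum_univ_four] <;> norm_num
  · intro k
    fin_cases k <;> simp [Fin.sum_univ_four, Fin.forall_fin_succ] <;> norm_num

lemma levelSixRatio_const_Y :
    ∃ C, ∀ τ, levelSixRatio ![-5, 1, -1, 5] ![-5, 7, 7, -5] τ = C := by
  have hc : ∑ i, (![-5, 1, -1, 5] : Fin 4 → ℤ) i = 0 := by simp [Fin.sum_univ_four]
  have hr : ∑ i, (![-5, 7, 7, -5] : Fin 4 → ℤ) i = 4 := by simp [Fin.sum_univ_four]
  refine levelSixRatio_const hc hr (levelSixRatio_isBounded_cuspRep hc hr ![0, 0, 1 / 3, 1 / 2]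
    ?_ ?_)
  · intro k
    fin_cases k <;> simp [Fin.sum_univ_four] <;> norm_num
  · intro k
    fin_cases k <;> simp [Fin.sum_univ_four, Fin.forall_fin_succ] <;> norm_num

/-! ### Eta quotients and their logarithmic derivatives -/

/-- The eta quotient `∏ η(m τ) ^ rₘ` over the divisors `m` of six. -/
noncomputable def etaProd (r : Fin 4 → ℤ) (τ : ℂ) : ℂ := ∏ i, eta (levels i * τ) ^ r i

lemma levels_mul_im_pos (i : Fin 4) {z : ℂ} (hz : 0 < z.im) : 0 < ((levels i : ℂ) * z).im := by
  simpa using affine_im_pos (B := 0) (levels_pos i) one_pos hz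

lemma coe_affineAct_levels (i : Fin 4) (τ : ℍ) :
    (affineAct (levels i) 0 1 τ : ℂ) = levels i * τ := by
  simp [coe_affineAct (levels_pos i) one_pos]

lemma etaProd_ne_zero (r : Fin 4 → ℤ) {z : ℂ} (hz : 0 < z.im) : etaProd r z ≠ 0 :=
  Finset.prod_ne_zero_iff.mpr fun i _ ↦ zpow_ne_zero _ (eta_ne_zero (levels_mul_im_pos i hz))

lemma etaProd_pow (r : Fin 4 → ℤ) (τ : ℍ) : etaProd r τ ^ 24 = deltaQuot r τ := by
  rw [etaProd, deltaQuot, ← Finset.prod_pow]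
  refine Finset.prod_congr rfl fun i _ ↦ ?_
  rw [discriminant, coe_affineAct_levels, ← zpow_natCast, ← zpow_natCast, ← zpow_mul, ← zpow_mul,
    mul_comm (r i)]

lemma hasDerivAt_eta_levels (i : Fin 4) {z : ℂ} (hz : 0 < z.im) :
    HasDerivAt (fun w ↦ eta (levels i * w)) (levels i * deriv eta (levels i * z)) z := by
  have h1 := (differentiableAt_eta_of_mem_upperHalfPlaneSet (levels_mul_im_pos i hz)).hasDerivAt
  have h2 := h1.comp z ((hasDerivAt_id z).const_mul (levels i : ℂ))
  rw [mul_one, mul_comm] at h2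
  exact h2

lemma hasDerivAt_etaProd (r : Fin 4 → ℤ) (τ : ℍ) :
    HasDerivAt (etaProd r) (2 * π * I * (E2comb r τ / 24) * etaProd r τ) τ := by
  have hne (i : Fin 4) : eta (levels i * τ) ≠ 0 := eta_ne_zero (levels_mul_im_pos i τ.im_pos)
  have hd (i : Fin 4) : DifferentiableAt ℂ (fun w ↦ eta (levels i * w) ^ r i) τ :=
    (hasDerivAt_eta_levels i τ.im_pos).differentiableAt.zpow (Or.inl (hne i))
  have hdiff : DifferentiableAt ℂ (etaProd r) τ := DifferentiableAt.fun_finsetProd fun i _ ↦ hd i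
  have hlog : logDeriv (etaProd r) τ = 2 * π * I * (E2comb r τ / 24) := by
    unfold etaProd
    rw [logDeriv_prod (f := fun i w ↦ eta (levels i * w) ^ r i)
      (fun i _ ↦ zpow_ne_zero _ (hne i)) (fun i _ ↦ hd i), E2comb,
      Finset.sum_div, Finset.mul_sum]
    refine Finset.sum_congr rfl fun i _ ↦ ?_
    have h1 := logDeriv_eta_eq_E2 (affineAct (levels i) 0 1 τ)
    rw [coe_affineAct_levels, logDeriv_apply] at h1
    rw [logDeriv_fun_zpow (hasDerivAt_eta_levels i τ.im_pos).differentiableAt, logDeriv_apply,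
      (hasDerivAt_eta_levels i τ.im_pos).deriv, mul_div_assoc, h1]
    ring
  rw [← hlog, logDeriv_apply, div_mul_cancel₀ _ (etaProd_ne_zero r τ.im_pos)]
  exact hdiff.hasDerivAt

/-- The quotient is continuous on the connected space ℍ and takes values among the finitely many
24th roots of `C`, so it is constant. -/
lemma exists_E2comb_eq_mul_etaProd {c r : Fin 4 → ℤ} (h : ∃ C, ∀ τ, levelSixRatio c r τ = C) :
    ∃ k, ∀ τ : ℍ, E2comb c τ = k * etaProd r τ := by
  obtain ⟨C, hC⟩ := h
  have hcont : Continuous fun τ : ℍ ↦ E2comb c τ / etaProd r τ := by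
    refine (mdifferentiable_E2comb c).continuous.div ?_ fun τ ↦ etaProd_ne_zero r τ.im_pos
    exact continuous_iff_continuousAt.mpr fun τ ↦
      (hasDerivAt_etaProd r τ).continuousAt.comp continuous_coe.continuousAt
  have hfin : Set.Finite {x : ℂ | x ^ 24 = C} := by
    have hp : (Polynomial.X ^ 24 - Polynomial.C C : Polynomial ℂ) ≠ 0 :=
      Polynomial.X_pow_sub_C_ne_zero (by norm_num) C
    refine (Polynomial.finite_setOfPred_isRoot hp).subset fun x hx ↦ ?_
    simpa [Polynomial.IsRoot, sub_eq_zero] using hx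
  have hconst : ∀ τ : ℍ, E2comb c τ / etaProd r τ = E2comb c UpperHalfPlane.I /
      etaProd r UpperHalfPlane.I := fun τ ↦
    isPreconnected_univ.constant_of_mapsTo (T := {x : ℂ | x ^ 24 = C}) hfin.isDiscrete
      hcont.continuousOn (fun σ _ ↦ by
        rw [Set.mem_ofPred_eq, div_pow, etaProd_pow]
        exact hC σ) (Set.mem_univ _) (Set.mem_univ _)
  exact ⟨E2comb c UpperHalfPlane.I / etaProd r UpperHalfPlane.I, fun τ ↦ by
    rw [← hconst τ, div_mul_cancel₀ _ (etaProd_ne_zero r τ.im_pos)]⟩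

/-! ### q-products and leading coefficients -/

lemma qqInf_zero : qqInf 0 = 1 := by simp [qqInf]

lemma differentiableAt_qqInf {q : ℂ} (hq : ‖q‖ < 1) : DifferentiableAt ℂ qqInf q :=
  differentiableOn_tprod_one_sub_pow.differentiableAt
    (Metric.isOpen_ball.mem_nhds (by simpa using hq))

lemma eta_mul_eq (m : ℕ) (z : ℂ) : eta (m * z) = 𝕢 24 z ^ m * qqInf (𝕢 1 z ^ m) := by
  have h1 : 𝕢 24 (m * z) = 𝕢 24 z ^ m := by
    simp only [Function.Periodic.qParam, ← Complex.exp_nat_mul]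
    congr 1
    ring
  have h2 : 𝕢 1 (m * z) = 𝕢 1 z ^ m := by
    simp only [Function.Periodic.qParam, ← Complex.exp_nat_mul]
    congr 1
    ring
  simp only [eta, eta_q, qqInf, h1, h2]

/-- The condition `hn` makes the fractional prefactors q^(m/24) combine into an integral power of q.
-/
lemma etaProd_eq (r : Fin 4 → ℤ) (n : ℕ) (hn : ∑ i, levels i * r i = 24 * n) (z : ℂ) :
    etaProd r z = 𝕢 1 z ^ n * (qqInf (𝕢 1 z) ^ r 0 * qqInf (𝕢 1 z ^ 2) ^ r 1 *
      qqInf (𝕢 1 z ^ 3) ^ r 2 * qqInf (𝕢 1 z ^ 6) ^ r 3) := by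
  have e1 := eta_mul_eq 1 z
  have e2 := eta_mul_eq 2 z
  have e3 := eta_mul_eq 3 z
  have e6 := eta_mul_eq 6 z
  have h0 : 𝕢 24 z ≠ 0 := Function.Periodic.qParam_ne_zero _
  have hq : 𝕢 1 z ^ n = 𝕢 24 z ^ r 0 * 𝕢 24 z ^ (2 * r 1) * 𝕢 24 z ^ (3 * r 2) *
      𝕢 24 z ^ (6 * r 3) := by
    rw [← zpow_add₀ h0, ← zpow_add₀ h0, ← zpow_add₀ h0]
    simp [Fin.sum_univ_four, levels] at hn
    rw [hn]
    simp only [Function.Periodic.qParam, ← Complex.exp_nat_mul, ← Complex.exp_int_mul]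
    congr 1
    push_cast
    ring
  rw [hq]
  simp only [Nat.cast_one, one_mul, pow_one, Nat.cast_ofNat] at e1 e2 e3 e6
  simp only [etaProd, Fin.prod_univ_four, levels, Matrix.cons_val, Int.cast_one, Int.cast_ofNat,
    one_mul, e1, e2, e3, e6, mul_zpow, zpow_mul, zpow_ofNat]
  ring

lemma tendsto_qqInf_qParam_pow {m : ℕ} (hm : m ≠ 0) :
    Tendsto (fun τ : ℍ ↦ qqInf (𝕢 1 τ ^ m)) atImInfty (𝓝 1) := by
  have h0 : Tendsto (fun τ : ℍ ↦ 𝕢 1 τ ^ m) atImInfty (𝓝 0) := by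
    simpa [hm] using (qParam_tendsto_atImInfty one_pos).pow m
  have h := (differentiableAt_qqInf (q := 0) (by simp)).continuousAt.tendsto.comp h0
  rwa [qqInf_zero] at h

lemma tendsto_etaProd_div (r : Fin 4 → ℤ) (n : ℕ) (hn : ∑ i, levels i * r i = 24 * n) :
    Tendsto (fun τ : ℍ ↦ etaProd r τ / 𝕢 1 τ ^ n) atImInfty (𝓝 1) := by
  have h (m : ℕ) (hm : m ≠ 0) (k : ℤ) :
      Tendsto (fun τ : ℍ ↦ qqInf (𝕢 1 τ ^ m) ^ k) atImInfty (𝓝 1) := by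
    simpa using (tendsto_qqInf_qParam_pow hm).zpow₀ k (Or.inl one_ne_zero)
  have h1 := (((h 1 (by simp) (r 0)).mul (h 2 (by simp) (r 1))).mul (h 3 (by simp) (r 2))).mul
    (h 6 (by simp) (r 3))
  simp only [mul_one, pow_one] at h1
  refine h1.congr fun τ ↦ ?_
  rw [etaProd_eq r n hn, mul_div_cancel_left₀ _
    (pow_ne_zero _ (Function.Periodic.qParam_ne_zero _))]

/-- The level is m + 1, so 0 ^ m is 1 at level one and 0 above: only E₂(τ) has a linear term in q.
-/
lemma tendsto_E2_affineAct (m : ℕ) :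
    Tendsto (fun τ : ℍ ↦ (E2 (affineAct (m + 1 : ℕ) 0 1 τ) - 1) / 𝕢 1 τ) atImInfty
      (𝓝 (-24 * 0 ^ m)) := by
  have hq (τ : ℍ) : 𝕢 1 τ ≠ 0 := Function.Periodic.qParam_ne_zero _
  have hq0 : Tendsto (fun τ : ℍ ↦ 𝕢 1 τ) atImInfty (𝓝 0) := qParam_tendsto_atImInfty one_pos
  have h1 : Tendsto (fun τ : ℍ ↦ (E2 τ - 1) / 𝕢 1 τ) atImInfty (𝓝 (-24)) := by
    have h2 : Tendsto (fun τ : ℍ ↦ (E2 τ - (1 - 24 * 𝕢 1 τ)) / 𝕢 1 τ) atImInfty (𝓝 0) := by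
      have h3 : (fun τ : ℍ ↦ (E2 τ - (1 - 24 * 𝕢 1 τ)) / 𝕢 1 τ) =O[atImInfty]
          fun τ : ℍ ↦ 𝕢 1 τ ^ 2 / 𝕢 1 τ := by
        simpa only [div_eq_mul_inv] using E2_sub_isBigO_sq.mul (isBigO_refl _ _)
      refine (h3.congr_right fun τ ↦ ?_).trans_tendsto hq0
      rw [sq, mul_div_cancel_right₀ _ (hq τ)]
    have h4 := h2.add_const (-24 : ℂ)
    rw [zero_add] at h4
    refine h4.congr fun τ ↦ ?_
    have := hq τ
    field_simp
    ring
  have hpos : (0 : ℤ) < (m + 1 : ℕ) := by positivity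
  refine ((h1.comp (tendsto_affineAct 0 hpos one_pos)).mul (hq0.pow m)).congr fun τ ↦ ?_
  have hqm : 𝕢 1 (affineAct (m + 1 : ℕ) 0 1 τ) = 𝕢 1 τ ^ (m + 1) := by
    rw [coe_affineAct hpos one_pos]
    simp only [Function.Periodic.qParam, ← Complex.exp_nat_mul]
    congr 1
    push_cast
    ring
  have := hq τ
  rw [Function.comp_apply, hqm]
  field_simp
  ring

lemma tendsto_E2comb_div (c : Fin 4 → ℤ) (hc : ∑ i, levels i * c i = 0) :
    Tendsto (fun τ : ℍ ↦ E2comb c τ / 𝕢 1 τ) atImInfty (𝓝 (-24 * c 0)) := by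
  have h := ((((tendsto_E2_affineAct 0).const_mul (c 0 : ℂ)).add
    ((tendsto_E2_affineAct 1).const_mul (2 * c 1 : ℂ))).add
    ((tendsto_E2_affineAct 2).const_mul (3 * c 2 : ℂ))).add
    ((tendsto_E2_affineAct 5).const_mul (6 * c 3 : ℂ))
  have hl : (c 0 * (-24 * 0 ^ 0) + 2 * c 1 * (-24 * 0 ^ 1) + 3 * c 2 * (-24 * 0 ^ 2) +
      6 * c 3 * (-24 * 0 ^ 5) : ℂ) = -24 * c 0 := by
    norm_num
    ring
  rw [hl] at h
  refine h.congr fun τ ↦ ?_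
  have hc' : (c 0 + 2 * c 1 + 3 * c 2 + 6 * c 3 : ℂ) = 0 := by
    simp [Fin.sum_univ_four, levels] at hc
    exact_mod_cast hc
  simp only [E2comb, Fin.sum_univ_four, levels, Matrix.cons_val]
  norm_num
  linear_combination (-1 / 𝕢 1 τ) * hc'

lemma tendsto_E2comb (c : Fin 4 → ℤ) :
    Tendsto (E2comb c) atImInfty (𝓝 (∑ i, c i * levels i)) := by
  have h0 : Tendsto (fun τ ↦ E2 τ) atImInfty (𝓝 1) := by
    have hexp : Tendsto (fun τ : ℍ ↦ Real.exp (-2 * π * τ.im)) atImInfty (𝓝 0) := by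
      refine Real.tendsto_exp_atBot.comp ?_
      exact tendsto_comap.const_mul_atTop_of_neg (by linarith [Real.pi_pos])
    simpa using (E2_sub_one_isBigO.trans_tendsto hexp).add_const 1
  refine tendsto_finsetSum _ fun i _ ↦ Tendsto.const_mul _ ?_
  simpa using (h0.comp (tendsto_affineAct 0 (levels_pos i) one_pos)).const_mul (levels i : ℂ)

/-! ### The two Eisenstein identities and W - 1 = 8V -/

lemma E2comb_W (τ : ℍ) : E2comb ![-8, 4, 8, -4] τ = 192 * etaProd ![-2, 4, -2, 4] τ := by
  obtain ⟨k, hk⟩ := exists_E2comb_eq_mul_etaProd levelSixRatio_const_W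
  -- Both sides vanish to order one in q, so linear coefficients are compared: -24 · (-8) = 192.
  have h1 := tendsto_E2comb_div ![-8, 4, 8, -4] (by simp [Fin.sum_univ_four, levels])
  have h2 := (tendsto_etaProd_div ![-2, 4, -2, 4] 1 (by simp [Fin.sum_univ_four, levels])).const_mul k
  have h3 := tendsto_nhds_unique h1 (h2.congr fun τ ↦ by rw [hk, pow_one, mul_div_assoc])
  rw [hk, ← mul_one k, ← h3]
  norm_num

lemma E2comb_Y (τ : ℍ) : E2comb ![-5, 1, -1, 5] τ = 24 * etaProd ![-5, 7, 7, -5] τ := by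
  obtain ⟨k, hk⟩ := exists_E2comb_eq_mul_etaProd levelSixRatio_const_Y
  -- Constant terms are compared: -5 + 2 - 3 + 30 = 24.
  have h1 := tendsto_E2comb ![-5, 1, -1, 5]
  have h2 := (tendsto_etaProd_div ![-5, 7, 7, -5] 0 (by simp [Fin.sum_univ_four, levels])).const_mul k
  have h3 := tendsto_nhds_unique h1 (h2.congr fun τ ↦ by rw [hk, pow_zero, div_one])
  rw [hk, ← mul_one k, ← h3]
  simp only [Fin.sum_univ_four, levels, Matrix.cons_val]
  norm_num

lemma etaProd_mul (r s : Fin 4 → ℤ) {z : ℂ} (hz : 0 < z.im) :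
    etaProd r z * etaProd s z = etaProd (r + s) z := by
  rw [etaProd, etaProd, etaProd, ← Finset.prod_mul_distrib]
  exact Finset.prod_congr rfl fun i _ ↦
    (zpow_add₀ (eta_ne_zero (levels_mul_im_pos i hz)) _ _).symm

lemma hasDerivAt_etaProd_sub (τ : ℍ) : HasDerivAt
    (fun z ↦ etaProd ![-8, 4, 8, -4] z - 8 * etaProd ![-5, 1, -1, 5] z) 0 τ := by
  have h := (hasDerivAt_etaProd ![-8, 4, 8, -4] τ).sub
    ((hasDerivAt_etaProd ![-5, 1, -1, 5] τ).const_mul 8)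
  refine h.congr_deriv ?_
  have h1 := etaProd_mul ![-2, 4, -2, 4] ![-8, 4, 8, -4] τ.im_pos
  have h2 := etaProd_mul ![-5, 7, 7, -5] ![-5, 1, -1, 5] τ.im_pos
  -- Both derivatives are multiples of the same eta quotient [-10,8,6,0], with equal factors 192/24
  -- = 8.
  have h3 : (![-2, 4, -2, 4] + ![-8, 4, 8, -4] : Fin 4 → ℤ) = ![-5, 7, 7, -5] + ![-5, 1, -1, 5] := by
    simp
  rw [h3, ← h2] at h1
  rw [E2comb_W, E2comb_Y]
  linear_combination 16 * π * I * h1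

lemma etaProd_sub_one {z : ℂ} (hz : 0 < z.im) :
    etaProd ![-8, 4, 8, -4] z - 1 = 8 * etaProd ![-5, 1, -1, 5] z := by
  have hconst (τ σ : ℍ) : etaProd ![-8, 4, 8, -4] τ - 8 * etaProd ![-5, 1, -1, 5] τ =
      etaProd ![-8, 4, 8, -4] σ - 8 * etaProd ![-5, 1, -1, 5] σ := by
    have hopen : IsOpen {w : ℂ | 0 < w.im} := isOpen_upperHalfPlaneSet
    refine hopen.is_const_of_deriv_eq_zero (convex_halfSpace_im_gt 0).isPreconnected
      (f := fun z ↦ etaProd ![-8, 4, 8, -4] z - 8 * etaProd ![-5, 1, -1, 5] z)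
      (fun w hw ↦ (hasDerivAt_etaProd_sub ⟨w, hw⟩).differentiableAt.differentiableWithinAt)
      (fun w hw ↦ (hasDerivAt_etaProd_sub ⟨w, hw⟩).deriv) τ.im_pos σ.im_pos
  -- At i∞ the first quotient tends to 1 and the second, of order q, to 0; the constant is therefore
  -- 1.
  have h1 := tendsto_etaProd_div ![-8, 4, 8, -4] 0 (by simp [Fin.sum_univ_four, levels])
  have h2 := (tendsto_etaProd_div ![-5, 1, -1, 5] 1 (by simp [Fin.sum_univ_four, levels])).mul
    (qParam_tendsto_atImInfty one_pos)
  have h3 := tendsto_nhds_unique (h1.sub (h2.const_mul 8))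
    ((tendsto_const_nhds (x := etaProd ![-8, 4, 8, -4] z - 8 * etaProd ![-5, 1, -1, 5] z)).congr
      fun σ ↦ by
      rw [hconst ⟨z, hz⟩ σ, pow_zero, div_one, pow_one,
        div_mul_cancel₀ _ (Function.Periodic.qParam_ne_zero _)])
  have h4 : etaProd ![-8, 4, 8, -4] z - 8 * etaProd ![-5, 1, -1, 5] z = 1 := by
    simpa using h3.symm
  linear_combination h4

/-! ### The differential equation in τ and in q -/

lemma etaW_eq_etaProd (z : ℂ) : etaW z = etaProd ![-8, 4, 8, -4] z := by
  simp only [etaW, etaProd, Fin.prod_univ_four, levels, Matrix.cons_val, Int.cast_one,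
    Int.cast_ofNat, one_mul, zpow_neg, zpow_ofNat]
  ring

lemma prodW_qParam (z : ℂ) : prodW (𝕢 1 z) = etaProd ![-8, 4, 8, -4] z := by
  rw [etaProd_eq _ 0 (by simp [Fin.sum_univ_four, levels])]
  simp only [prodW, Matrix.cons_val, zpow_neg, zpow_ofNat]
  ring

lemma eta_quotient_eq_etaProd (z : ℂ) :
    eta (2 * z) ^ 7 * eta (3 * z) ^ 7 / (eta z ^ 5 * eta (6 * z) ^ 5) =
      etaProd ![-5, 7, 7, -5] z := by
  simp only [etaProd, Fin.prod_univ_four, levels, Matrix.cons_val, Int.cast_one,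
    Int.cast_ofNat, one_mul, zpow_neg, zpow_ofNat]
  ring

lemma qqInf_quotient_eq_etaProd (z : ℂ) :
    qqInf (𝕢 1 z ^ 2) ^ 7 * qqInf (𝕢 1 z ^ 3) ^ 7 / (qqInf (𝕢 1 z) ^ 5 * qqInf (𝕢 1 z ^ 6) ^ 5) =
      etaProd ![-5, 7, 7, -5] z := by
  rw [etaProd_eq _ 0 (by simp [Fin.sum_univ_four, levels])]
  simp only [Matrix.cons_val, zpow_neg, zpow_ofNat]
  ring

lemma hasDerivAt_etaProd_W {z : ℂ} (hz : 0 < z.im) : HasDerivAt (etaProd ![-8, 4, 8, -4])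
    (2 * π * I * etaProd ![-5, 7, 7, -5] z * (etaProd ![-8, 4, 8, -4] z - 1)) z := by
  -- W is written as 8V + (W - 8V), whose second summand has derivative zero.
  have h := ((hasDerivAt_etaProd ![-5, 1, -1, 5] ⟨z, hz⟩).const_mul 8).add
    (hasDerivAt_etaProd_sub ⟨z, hz⟩)
  refine (h.congr_deriv ?_).congr_of_eventuallyEq (.of_forall fun w ↦ ?_)
  · rw [E2comb_Y, etaProd_sub_one hz]
    ring
  · simp

/-- Inherited from the nonvanishing of η on the upper half-plane. -/
lemma qqInf_qParam_pow_ne_zero {z : ℂ} (hz : 0 < z.im) {m : ℕ} (hm : m ≠ 0) :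
    qqInf (𝕢 1 z ^ m) ≠ 0 := by
  have h : 0 < ((m : ℂ) * z).im := by
    have : (0 : ℝ) < m := by positivity
    simpa using mul_pos this hz
  have h1 := eta_ne_zero h
  rw [eta_mul_eq] at h1
  exact right_ne_zero_of_mul h1

lemma differentiableAt_prodW {z : ℂ} (hz : 0 < z.im) : DifferentiableAt ℂ prodW (𝕢 1 z) := by
  have hd {m : ℕ} (hm : m ≠ 0) : DifferentiableAt ℂ (fun q ↦ qqInf (q ^ m)) (𝕢 1 z) := by
    have hq : ‖𝕢 1 z ^ m‖ < 1 := by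
      rw [norm_pow]
      exact pow_lt_one₀ (norm_nonneg _) (Function.Periodic.norm_qParam_lt_one one_pos hz) hm
    exact (differentiableAt_qqInf hq).comp (f := fun q : ℂ ↦ q ^ m) _ (by fun_prop)
  have hd1 := hd one_ne_zero
  have hn1 := qqInf_qParam_pow_ne_zero hz one_ne_zero
  simp only [pow_one] at hd1 hn1
  exact (((hd two_ne_zero).mul ((hd three_ne_zero).pow 2)).div ((hd1.pow 2).mul (hd (by simp)))
    (mul_ne_zero (pow_ne_zero _ hn1) (qqInf_qParam_pow_ne_zero hz (by simp)))).pow 4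

lemma qParam_mul_deriv_prodW {z : ℂ} (hz : 0 < z.im) : 𝕢 1 z * deriv prodW (𝕢 1 z) =
    etaProd ![-5, 7, 7, -5] z * (etaProd ![-8, 4, 8, -4] z - 1) := by
  have hq : HasDerivAt (𝕢 1) (2 * π * I * 𝕢 1 z) z := by
    have hfun : 𝕢 1 = fun w : ℂ ↦ cexp (2 * π * I * w) := by
      ext w
      simp [Function.Periodic.qParam]
    rw [hfun]
    exact (((hasDerivAt_id z).const_mul (2 * π * I : ℂ)).cexp).congr_deriv (by simp [mul_comm])
  -- Since dq/dτ = 2πi q, the chain rule turns the equation in τ into the one in q after cancelling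
  -- 2πi.
  have h1 := (differentiableAt_prodW hz).hasDerivAt.comp z hq
  have h2 : prodW ∘ 𝕢 1 = etaProd ![-8, 4, 8, -4] := funext prodW_qParam
  rw [h2] at h1
  have h3 := h1.unique (hasDerivAt_etaProd_W hz)
  apply mul_left_cancel₀ two_pi_I_ne_zero
  linear_combination h3

end LevelSix

theorem mainTheorem4 (τ : ℂ) (hτ : 0 < τ.im) (q : ℂ)
    (hq : q = Complex.exp (2 * Real.pi * Complex.I * τ)) :
    -- the two expressions for `W` agree
    etaW τ = prodW q ∧
    -- the differential equation in the variable `q`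
    (DifferentiableAt ℂ prodW q ∧
      q * deriv prodW q =
        (qqInf (q ^ 2) ^ 7 * qqInf (q ^ 3) ^ 7) / (qqInf q ^ 5 * qqInf (q ^ 6) ^ 5)
          * (prodW q - 1)) ∧
    -- the differential equation in the variable `τ`
    HasDerivAt etaW
      (2 * Real.pi * Complex.I *
        ((ModularForm.eta (2 * τ) ^ 7 * ModularForm.eta (3 * τ) ^ 7) /
          (ModularForm.eta τ ^ 5 * ModularForm.eta (6 * τ) ^ 5))
        * (etaW τ - 1)) τ := by
  have hq' : q = Function.Periodic.qParam 1 τ := by simp [hq, Function.Periodic.qParam]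
  rw [hq', eta_quotient_eq_etaProd, qqInf_quotient_eq_etaProd, prodW_qParam, funext etaW_eq_etaProd]
  exact ⟨rfl, ⟨differentiableAt_prodW hτ, qParam_mul_deriv_prodW hτ⟩, hasDerivAt_etaProd_W hτ⟩
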